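/- Throughout, $k\ge 1$ is an integer and a dynamical system $(X,\mathbb{Z}^k)$ is a compact metric space $X$ with an action of $\mathbb{Z}^k$ by homeomorphisms, written $(g,x)\mapsto gx$. For a finite open cover $\alpha$ of a space $Y$ let $\operatorname{ord}(\alpha)=-1+\max_{y\in Y}\#\{U\in\alpha: y\in U\}$, let $D(\alpha)$ be the minimum of $\operatorname{ord}(\beta)$ over the finite open covers $\beta$ refining $\alpha$, and let $\dim(Y)=\sup_\alpha D(\alpha)$ be the Lebesgue covering dimension (for the empty space we put $\operatorname{ord}=\dim=0$). For a subgroup $A\le\mathbb{Z}^k$ put $X_A=\{x\in X: ax=x \text{ for all } a\in A\}$; the quotient group $\mathbb{Z}^k/A$ acts on $X_A$ by $(g+A)x=gx$. For a countable abelian group $G$ acting continuously on a compact metric space $(Y,\rho)$, the mean dimension is $$\operatorname{mdim}(Y,G)=\sup_{\epsilon>0}\ \lim_{F}\ \frac{\operatorname{Widim}_\epsilon(Y,\rho_F)}{\#F},\qquad \rho_F(x,y)=\max_{g\in F}\rho(gx,gy),$$ where the limit is along F\o lner sequences of finite sets $F\subset G$ and $\operatorname{Widim}_\epsilon(Y,\rho_F)$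 is the least order of a finite open cover of $Y$ whose members have $\rho_F$-diameter at most $\epsilon$. **Theorem.** Let $(X,\mathbb{Z}^k)$ be a dynamical system. (1) Let $d\ge 0$ and $m\ge 1$ be integers. Suppose that $\dim(X)=d$ and that $$\frac{\dim(X_A)}{[\mathbb{Z}^k:A]}<\frac m2\qquad\text{for every subgroup } A\le\mathbb{Z}^k \text{ with } [\mathbb{Z}^k:A]\le 2d .$$ Then the set of continuous functions $f:X\to[0,1]^m$ for which $$f_{2d}:X\to([0,1]^m)^{[0,2d]^k\cap\mathbb{Z}^k},\qquad x\mapsto (f(ix))_{i\in[0,2d]^k\cap\mathbb{Z}^k}$$ is an embedding (a homeomorphism onto its image) is comeagre in $C(X,[0,1]^m)$ with respect to the supremum topology. (2) (The embedding conjecture for $\mathbb{Z}^k$-actions holds for finite-dimensional systems.) Let $D\ge 1$ be an integer. Suppose that $\dim(X)<\infty$ and that $\operatorname{mdim}(X_A,\mathbb{Z}^k/A)<D/2$ for every subgroup $A$ of $\mathbb{Z}^k$. Then $(X,\mathbb{Z}^k)$ embeds into the $D$-cubical shift: there is a topological embedding $\varphi:X\to([0,1]^D)^{\mathbb{Z}^k}$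 with $\varphi(nx)=\sigma^n(\varphi(x))$ for all $n\in\mathbb{Z}^k$ and $x\in X$, where $(\sigma^n\omega)_w=\omega_{w+n}$. -/

import Mathlib

open Filter Topology Set
open scoped unitInterval ENNReal NNReal

noncomputable section

namespace TakensZk

/-- `α` is a finite open cover of `X`. -/
def IsFiniteOpenCover {X : Type*} [TopologicalSpace X] (α : Set (Set X)) : Prop :=
  α.Finite ∧ (∀ U ∈ α, IsOpen U) ∧ ⋃₀ α = univ

/-- `β` refines `α`: every member of `β` is contained in a member of `α`. -/
def Refines {X : Type*} (β α : Set (Set X)) : Prop :=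
  ∀ V ∈ β, ∃ U ∈ α, V ⊆ U

/-- The order of a family of sets: the largest number of members containing a common point,
minus one. (On the empty space this is `0`, by truncation.) -/
def coverOrder {X : Type*} (α : Set (Set X)) : ℕ∞ :=
  (⨆ x : X, {U | U ∈ α ∧ x ∈ U}.encard) - 1

/-- `D(α)`: the least order of a finite open cover refining `α`. -/
def coverDim {X : Type*} [TopologicalSpace X] (α : Set (Set X)) : ℕ∞ :=
  ⨅ (β : Set (Set X)) (_ : IsFiniteOpenCover β) (_ : Refines β α), coverOrder β

/-- The Lebesgue covering dimension of a space, as an extended natural number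
(the empty space gets the value `0`). -/
def lebesgueDim (X : Type*) [TopologicalSpace X] : ℕ∞ :=
  ⨆ (α : Set (Set X)) (_ : IsFiniteOpenCover α), coverDim α

/-- `Widim_ε(X, ρ)`: the least order of a finite open cover of `X` all of whose members have
`ρ`-diameter at most `ε`. -/
def widim {X : Type*} [TopologicalSpace X] (ρ : X → X → ℝ≥0) (ε : ℝ≥0) : ℕ∞ :=
  ⨅ (α : Set (Set X)) (_ : IsFiniteOpenCover α)
    (_ : ∀ U ∈ α, ∀ x ∈ U, ∀ y ∈ U, ρ x y ≤ ε), coverOrder α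

/-- The metric `d_F(x, y) = max_{g ∈ F} d(gx, gy)`, for a finite set `F` of group elements. -/
def dynDist {G X : Type*} [AddCommGroup G] [MetricSpace X] [AddAction G X]
    (F : Finset G) (x y : X) : ℝ≥0 :=
  F.sup fun g => nndist (g +ᵥ x) (g +ᵥ y)

open Classical in
/-- The Følner filter on the finite subsets of an abelian group `G`: it is generated by the sets
of all nonempty finite `F ⊆ G` with `|(g + F) ∆ F| ≤ δ |F|` for all `g ∈ K`, where `K` runs over
the finite subsets of `G` and `δ` over the positive reals. A sequence of finite sets tends to this
filter if and only if it is a Følner sequence of `G`. -/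
def folner (G : Type*) [AddCommGroup G] : Filter (Finset G) :=
  ⨅ (K : Finset G) (δ : ℝ) (_ : 0 < δ),
    𝓟 {F : Finset G | F.Nonempty ∧
      ∀ g ∈ K, ((symmDiff (F.image fun h => g + h) F).card : ℝ) ≤ δ * (F.card : ℝ)}

/-- The mean dimension of an action of a countable abelian (hence amenable) group `G` on a compact
metric space `X`: the supremum over `ε > 0` of the limit of `Widim_ε(X, d_F) / |F|` along Følner
sets `F`. The limit exists by the Ornstein-Weiss lemma, so it may be written as a `limsup`. -/
def meanDim (G X : Type*) [AddCommGroup G] [MetricSpace X] [AddAction G X] : ℝ≥0∞ :=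
  ⨆ (ε : ℝ≥0) (_ : 0 < ε),
    limsup (fun F : Finset G =>
      ((widim (dynDist F : X → X → ℝ≥0) ε : ℕ∞) : ℝ≥0∞) / (F.card : ℝ≥0∞)) (folner G)

section Action

variable {G X : Type*} [AddCommGroup G] [AddAction G X]

/-- `X_A`, the set of points that are fixed by every element of the subgroup `A`. -/
def fixedSet (X : Type*) [AddAction G X] (A : AddSubgroup G) : Set X :=
  {x | ∀ a ∈ A, a +ᵥ x = x}

theorem vadd_mem_fixedSet (A : AddSubgroup G) (g : G) {x : X} (hx : x ∈ fixedSet X A) :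
    g +ᵥ x ∈ fixedSet X A := by
  intro a ha
  rw [vadd_vadd, add_comm, ← vadd_vadd, hx a ha]

/-- The natural action of `G / A` on `X_A`, given by `(g + A) x = g x`. -/
instance quotientAction (A : AddSubgroup G) : AddAction (G ⧸ A) (fixedSet X A) where
  vadd q x := Quotient.liftOn' q
    (fun g => (⟨g +ᵥ (x : X), vadd_mem_fixedSet A g x.2⟩ : fixedSet X A))
    (by
      intro g h hgh
      apply Subtype.ext
      have h1 : (-g + h) +ᵥ (x : X) = x := x.2 _ (QuotientAddGroup.leftRel_apply.mp hgh)
      have h2 : g +ᵥ ((-g + h) +ᵥ (x : X)) = g +ᵥ (x : X) := by rw [h1]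
      rw [vadd_vadd, add_neg_cancel_left] at h2
      exact h2.symm)
  zero_vadd x := Subtype.ext (zero_vadd G (x : X))
  add_vadd q r x := by
    induction q using QuotientAddGroup.induction_on with
    | H g =>
      induction r using QuotientAddGroup.induction_on with
      | H h => exact Subtype.ext (add_vadd g h (x : X))

theorem coe_quotient_vadd (A : AddSubgroup G) (g : G) (x : fixedSet X A) :
    (((g : G ⧸ A) +ᵥ x : fixedSet X A) : X) = g +ᵥ (x : X) := rfl

end Action

/-- The delay map `x ↦ (f (i x))_{i ∈ [0, n]^k ∩ ℤ^k}` of an observable `f : X → Y`. -/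
def delayMap {k : ℕ} {X Y : Type*} [AddAction (Fin k → ℤ) X] (n : ℕ) (f : X → Y) :
    X → (Set.Icc (0 : Fin k → ℤ) (fun _ => (n : ℤ)) → Y) :=
  fun x i => f ((i : Fin k → ℤ) +ᵥ x)

/-- The shift action of `ℤ^k` on `Y^{ℤ^k}`: `(σ^n ω)_w = ω_{w + n}`. -/
def shift {k : ℕ} {Y : Type*} (n : Fin k → ℤ) (ω : (Fin k → ℤ) → Y) : (Fin k → ℤ) → Y :=
  fun w => ω (w + n)

end TakensZk

end

/-! An observable fails to separate `x` from `y` when its values along the two orbit windows agree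
entry by entry, that is, when finitely many values are invariant under a relation `r` on the
translates involved. Only distinct translates can receive independent values, so window indices are
first replaced by representatives modulo the stabilizers. If `P` denotes the representatives used
for one orbit, `r` leaves at most half as many classes as there are translates in total.

The points having at least the periods of `x` in a large box form a closed set of some dimension at
most `D` with `2 * D < m * P.card` (`exists_lebesgueDim_le`): either `P` has more than `2 * d`
elements, or the stabilizer has index at most `2 * d` and at most `P.card`, and the set lies in the
corresponding `fixedSet`. Thus `m` times the number of classes, plus the dimensions, is less than
`m` times the number of translates. General position (`dense_generalPosition`), carried to functions
by partitions of unity (`exists_perturbation`) and by Tietze extension, then removes all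
coincidences near the pair by a small perturbation; compactness makes the condition open
(`exists_ball_residual`).

Since points near `x` may have fewer periods than `x`, pairs are sorted by `orbitPattern`. For each
of the countably many patterns, the Lindelöf property leaves countably many local conditions.
Injectivity then gives an embedding by compactness.

For the second claim, a finite quotient group is itself a Følner set, so its mean dimension bounds
dimension divided by index. The first claim applies with `m = D`, and the full orbit map is
injective because its finite window is. -/

namespace TakensZk

/-! ### General position by counting parameters -/

section GeneralPosition

variable {ι : Type*} {J P : ι → Type*}

/-- The tuple of positions that takes the vertices other than `j₀ a` from `x.2.2`, and places the
vertex `j₀ a` so that a weighted sum of the vertices is the `r`-invariant tuple `x.2.1`. -/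
noncomputable def degenerateParam [∀ a, DecidableEq (J a)] (r : (Σ a, P a) → (Σ a, P a) → Prop)
    (m : ℕ) (τ : ∀ a, Finset (J a)) (j₀ : ∀ a, J a)
    (x : (∀ a, ((τ a).erase (j₀ a) → ℝ)) × (Quot r → Fin m → ℝ) ×
      (∀ a, {j : J a // j ≠ j₀ a} → P a → Fin m → ℝ)) :
    ∀ a, J a → P a → Fin m → ℝ := fun a j p c =>
  if h : j = j₀ a then
    (1 + ∑ i, x.1 a i) * x.2.1 (Quot.mk r ⟨a, p⟩) c -
      ∑ i : (τ a).erase (j₀ a), x.1 a i * x.2.2 a ⟨i, Finset.ne_of_mem_erase i.2⟩ p c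
  else x.2.2 a ⟨j, h⟩ p c

variable [Fintype ι] [∀ a, Fintype (J a)] [∀ a, Fintype (P a)]

theorem contDiff_degenerateParam [∀ a, DecidableEq (J a)]
    (r : (Σ a, P a) → (Σ a, P a) → Prop) [Fintype (Quot r)]
    (m : ℕ) (τ : ∀ a, Finset (J a)) (j₀ : ∀ a, J a) :
    ContDiff ℝ 1 (degenerateParam r m τ j₀) := by
  refine contDiff_pi.2 fun a => contDiff_pi.2 fun j => contDiff_pi.2 fun p => contDiff_pi.2
    fun c => ?_
  have h₁ := fun a => contDiff_pi.1 (contDiff_pi.1 (contDiff_fst (𝕜 := ℝ) (n := 1)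
    (E := ∀ a, ((τ a).erase (j₀ a) → ℝ)) (F := (Quot r → Fin m → ℝ) ×
      (∀ a, {j : J a // j ≠ j₀ a} → P a → Fin m → ℝ))) a)
  have h₂ : ∀ q c, ContDiff ℝ 1 fun x : (∀ a, ((τ a).erase (j₀ a) → ℝ)) × (Quot r → Fin m → ℝ) ×
      (∀ a, {j : J a // j ≠ j₀ a} → P a → Fin m → ℝ) => x.2.1 q c :=
    fun q => contDiff_pi.1 (contDiff_pi.1 contDiff_snd.fst q)
  have h₃ : ∀ a j p c, ContDiff ℝ 1 fun x : (∀ a, ((τ a).erase (j₀ a) → ℝ)) ×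
      (Quot r → Fin m → ℝ) × (∀ a, {j : J a // j ≠ j₀ a} → P a → Fin m → ℝ) => x.2.2 a j p c :=
    fun a j p => contDiff_pi.1 (contDiff_pi.1 (contDiff_pi.1 (contDiff_pi.1
      contDiff_snd.snd a) j) p)
  unfold degenerateParam
  by_cases h : j = j₀ a
  · simp only [h, dite_true]
    exact ((contDiff_const.add (ContDiff.sum fun i _ => h₁ a i)).mul (h₂ _ c)).sub
      (ContDiff.sum fun i _ => (h₁ a i).mul (h₃ a _ p c))
  · simp only [h, dite_false]
    exact h₃ a _ p c

/-- The vertices other than `j₀ a` occur on both sides. What remains is at most `D a` weight ratios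
for each `a` and `m` coordinates per class, against `m` coordinates per element of each `P a` for
the vertex `j₀ a`: this is exactly `hD`. -/
theorem finrank_degenerateParam_lt [∀ a, DecidableEq (J a)]
    (r : (Σ a, P a) → (Σ a, P a) → Prop) [Fintype (Quot r)]
    (m : ℕ) (τ : ∀ a, Finset (J a)) (j₀ : ∀ a, J a) (D : ι → ℕ)
    (hτ : ∀ a, (τ a).card ≤ D a + 1) (hj₀ : ∀ a, j₀ a ∈ τ a)
    (hD : m * Fintype.card (Quot r) + ∑ a, D a < m * ∑ a, Fintype.card (P a)) :
    Module.finrank ℝ ((∀ a, ((τ a).erase (j₀ a) → ℝ)) × (Quot r → Fin m → ℝ) ×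
      (∀ a, {j : J a // j ≠ j₀ a} → P a → Fin m → ℝ)) <
    Module.finrank ℝ (∀ a, J a → P a → Fin m → ℝ) := by
  simp only [Module.finrank_prod, Module.finrank_pi_fintype, Module.finrank_self,
    Finset.sum_const, Finset.card_univ, smul_eq_mul, mul_one, Fintype.card_fin,
    Fintype.card_coe]
  have h1 : ∑ a, ((τ a).erase (j₀ a)).card ≤ ∑ a, D a := by
    refine Finset.sum_le_sum fun a _ => ?_
    rw [Finset.card_erase_of_mem (hj₀ a)]
    have := hτ a
    omega
  have h2 : ∑ a, Fintype.card (J a) * (Fintype.card (P a) * m) =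
      (∑ a, Fintype.card {j : J a // j ≠ j₀ a} * (Fintype.card (P a) * m)) +
        m * ∑ a, Fintype.card (P a) := by
    rw [Finset.mul_sum, ← Finset.sum_add_distrib]
    refine Finset.sum_congr rfl fun a _ => ?_
    have : Fintype.card (J a) = Fintype.card {j : J a // j ≠ j₀ a} + 1 := by
      have := Fintype.card_pos_iff.2 ⟨j₀ a⟩
      rw [Fintype.card_subtype_compl, Fintype.card_subtype_eq]
      omega
    rw [this]
    ring
  rw [h2, mul_comm (Fintype.card (Quot r)) m]
  omega

/-- General position: for a dense set of vertex positions, no system of weights with small supports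
gives a weighted sum which is invariant under the relation `r`. -/
theorem dense_generalPosition (r : (Σ a, P a) → (Σ a, P a) → Prop) (m : ℕ) (D : ι → ℕ)
    (hD : m * Nat.card (Quot r) + ∑ a, D a < m * ∑ a, Fintype.card (P a)) :
    Dense {v : ∀ a, J a → P a → Fin m → ℝ | ∀ w : ∀ a, J a → ℝ,
      (∀ a, ∑ j, w a j = 1) → (∀ a, {j | w a j ≠ 0}.ncard ≤ D a + 1) →
      ∃ q q', r q q' ∧ ∑ j, w q.1 j • v q.1 j q.2 ≠ ∑ j, w q'.1 j • v q'.1 j q'.2} := by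
  classical
  have : Fintype (Quot r) := Fintype.ofFinite _
  rw [Nat.card_eq_fintype_card] at hD
  set S : Set ((a : ι) → J a → P a → Fin m → ℝ) :=
    ⋃ (s : (∀ a, Finset (J a)) × (∀ a, J a)) (_ : s ∈ {s : (∀ a, Finset (J a)) × (∀ a, J a) |
      (∀ a, (s.1 a).card ≤ D a + 1) ∧ ∀ a, s.2 a ∈ s.1 a}),
      range (degenerateParam r m s.1 s.2) with hS
  have hdense : Dense Sᶜ := by
    -- Without an admissible choice of supports and base vertices there is nothing to avoid.
    -- Otherwise any one choice shows the ambient dimension to be positive, so that the dimension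
    -- minus one is a uniform bound for the whole union.
    rcases Set.eq_empty_or_nonempty {s : (∀ a, Finset (J a)) × (∀ a, J a) |
      (∀ a, (s.1 a).card ≤ D a + 1) ∧ ∀ a, s.2 a ∈ s.1 a} with he | ⟨s, hs⟩
    · rw [hS, he]
      simp
    · refine dense_compl_of_dimH_lt_finrank ?_
      rw [hS, dimH_bUnion (Set.to_countable _)]
      have hlt := finrank_degenerateParam_lt r m s.1 s.2 D hs.1 hs.2 hD
      refine lt_of_le_of_lt (iSup₂_le fun s hs => ?_)
        (Nat.cast_lt.2 (Nat.sub_one_lt (Nat.ne_zero_of_lt hlt)))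
      refine (contDiff_degenerateParam r m s.1 s.2).dimH_range_le.trans ?_
      have := finrank_degenerateParam_lt r m s.1 s.2 D hs.1 hs.2 hD
      exact_mod_cast Nat.le_sub_one_of_lt this
  refine hdense.mono ?_
  intro v hv w hw hcard
  by_contra! hcon
  apply hv
  have hex : ∀ a, ∃ j, w a j ≠ 0 := fun a => by
    by_contra! h
    have := hw a
    simp [h] at this
  choose j₀ hj₀ using hex
  have hmem : ∀ a j, j ∈ Finset.univ.filter (fun j => w a j ≠ 0) ↔ w a j ≠ 0 := by simp
  refine mem_iUnion₂.2 ⟨(fun a => Finset.univ.filter fun j => w a j ≠ 0, j₀),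
    ⟨fun a => ?_, fun a => (hmem _ _).2 (hj₀ a)⟩, ?_⟩
  · have := hcard a
    rwa [Set.ncard_eq_toFinset_card', Set.toFinset_ofPred] at this
  -- Solve the weighted sum for the vertex `j₀ a`. As the weights sum to one, the reciprocal of `w a
  -- (j₀ a)` is one plus the sum of the ratios; by `hcon` the weighted sums descend to `Quot r`.
  refine ⟨(fun a i => w a i / w a (j₀ a),
    fun q c => Quot.lift (fun q : Σ a, P a => ∑ j, w q.1 j • v q.1 j q.2) hcon q c,
    fun a j p c => v a j p c), ?_⟩
  funext a j p c
  by_cases h : j = j₀ a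
  · subst h
    have h0 := hj₀ a
    have key : ∀ g : J a → ℝ, ∑ j, w a j * g j = w a (j₀ a) * g (j₀ a) +
        ∑ i : (Finset.univ.filter (fun j => w a j ≠ 0)).erase (j₀ a), w a i * g i := by
      intro g
      rw [Finset.sum_coe_sort _ (fun i => w a i * g i),
        Finset.add_sum_erase _ (fun i => w a i * g i) ((hmem _ _).2 h0),
        Finset.sum_filter_of_ne]
      intro x _ hx h
      simp [h] at hx
    have k1 := key (fun _ => 1)
    have k2 := key (fun j => v a j p c)
    simp only [mul_one, hw a] at k1
    simp only [degenerateParam, dite_true, Finset.sum_apply, Pi.smul_apply, smul_eq_mul, k2]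
    simp only [div_mul_eq_mul_div, ← Finset.sum_div]
    field_simp
    rw [← k1]
    ring
  · simp [degenerateParam, h]

end GeneralPosition

/-! ### Covering dimension and partitions of unity -/

section Covers

theorem coverOrder_le_iff {X : Type*} {α : Set (Set X)} {D : ℕ} :
    coverOrder α ≤ D ↔ ∀ x : X, {U | U ∈ α ∧ x ∈ U}.encard ≤ D + 1 := by
  rw [coverOrder, tsub_le_iff_right, iSup_le_iff]

theorem coverDim_le {X : Type*} [TopologicalSpace X] {α β : Set (Set X)}
    (hβ : IsFiniteOpenCover β) (hr : Refines β α) : coverDim α ≤ coverOrder β := by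
  unfold coverDim
  exact (iInf_le _ β).trans ((iInf_le _ hβ).trans (iInf_le _ hr))

theorem exists_refinement {X : Type*} [TopologicalSpace X] {D : ℕ} (hD : lebesgueDim X ≤ D)
    {α : Set (Set X)} (hα : IsFiniteOpenCover α) :
    ∃ β, IsFiniteOpenCover β ∧ Refines β α ∧ coverOrder β ≤ D := by
  have h : coverDim α < (D : ℕ∞) + 1 :=
    lt_of_le_of_lt ((le_iSup₂ (f := fun α _ => coverDim α) α hα).trans hD)
      (ENat.lt_add_one_iff (ENat.natCast_ne_top D) |>.2 le_rfl)
  simp only [coverDim, iInf_lt_iff] at h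
  obtain ⟨β, hβ, hr, ho⟩ := h
  exact ⟨β, hβ, hr, (ENat.lt_add_one_iff (ENat.natCast_ne_top D)).1 ho⟩

/-- Open sets of `X` extend to `Y`, and the complement of the closed range completes a cover; a
refinement pulled back along `e` has no larger order. -/
theorem lebesgueDim_le_of_isClosedEmbedding {X Y : Type*} [TopologicalSpace X]
    [TopologicalSpace Y] {e : X → Y} (he : IsClosedEmbedding e) :
    lebesgueDim X ≤ lebesgueDim Y := by
  refine iSup₂_le fun α hα => ?_
  have hV : ∀ U : α, ∃ V : Set Y, IsOpen V ∧ e ⁻¹' V = U := fun U =>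
    he.isInducing.isOpen_iff.1 (hα.2.1 U U.2)
  choose V hVo hVe using hV
  have hα' : IsFiniteOpenCover (insert (range e)ᶜ (range V)) := by
    have := hα.1.to_subtype
    refine ⟨(finite_range V).insert _, ?_, ?_⟩
    · rintro W (rfl | ⟨U, rfl⟩)
      · exact he.isClosed_range.isOpen_compl
      · exact hVo U
    · refine eq_univ_of_forall fun y => ?_
      by_cases hy : y ∈ range e
      · obtain ⟨x, rfl⟩ := hy
        obtain ⟨U, hU, hx⟩ := mem_sUnion.1 (hα.2.2.symm ▸ mem_univ x : x ∈ ⋃₀ α)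
        refine mem_sUnion.2 ⟨V ⟨U, hU⟩, mem_insert_of_mem _ ⟨_, rfl⟩, ?_⟩
        rw [← mem_preimage, hVe]
        exact hx
      · exact mem_sUnion.2 ⟨_, mem_insert _ _, hy⟩
  refine le_trans ?_ (le_iSup₂ (f := fun α _ => coverDim α) _ hα')
  refine le_iInf fun β => le_iInf fun hβ => le_iInf fun hr => ?_
  -- Members of `β` inside the complement of the range pull back to the empty set. It is discarded,
  -- since an empty `α` would have no member containing it.
  have hβ' : IsFiniteOpenCover ((e ⁻¹' ·) '' β \ {∅}) := by
    refine ⟨(hβ.1.image _).subset sdiff_subset, ?_, ?_⟩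
    · rintro _ ⟨⟨W, hW, rfl⟩, -⟩
      exact (hβ.2.1 W hW).preimage he.continuous
    · refine eq_univ_of_forall fun x => ?_
      obtain ⟨W, hW, hx⟩ := mem_sUnion.1 (hβ.2.2.symm ▸ mem_univ (e x) : e x ∈ ⋃₀ β)
      exact mem_sUnion.2 ⟨e ⁻¹' W, ⟨⟨W, hW, rfl⟩, (nonempty_of_mem (x := x) hx).ne_empty⟩, hx⟩
  have hr' : Refines ((e ⁻¹' ·) '' β \ {∅}) α := by
    rintro _ ⟨⟨W, hW, rfl⟩, hne⟩
    obtain ⟨x, hx⟩ := nonempty_iff_ne_empty.2 hne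
    obtain ⟨W', rfl | ⟨U, rfl⟩, hWW'⟩ := hr W hW
    · exact absurd (mem_range_self x) (hWW' hx)
    · exact ⟨U, U.2, hVe U ▸ preimage_mono hWW'⟩
  refine (coverDim_le hβ' hr').trans ?_
  refine tsub_le_tsub_right (iSup_le fun x => ?_) 1
  refine le_trans ?_ (le_iSup (fun y : Y => {U | U ∈ β ∧ y ∈ U}.encard) (e x))
  refine le_trans (encard_le_encard ?_) (encard_image_le (e ⁻¹' ·) _)
  rintro _ ⟨⟨⟨W, hW, rfl⟩, -⟩, hx⟩
  exact ⟨W, ⟨hW, hx⟩, rfl⟩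

/-- On a space of dimension at most `D`, every finite open cover has a subordinate partition of
unity of which at most `D + 1` members are nonzero at each point. -/
theorem exists_partitionOfUnity {X : Type*} [TopologicalSpace X] [CompactSpace X] [T2Space X]
    {D : ℕ} (hD : lebesgueDim X ≤ D) {α : Set (Set X)} (hα : IsFiniteOpenCover α) :
    ∃ (β : Set (Set X)) (_ : Fintype β) (ψ : β → C(X, ℝ)), (∀ U x, 0 ≤ ψ U x) ∧
      (∀ x, ∑ U, ψ U x = 1) ∧ (∀ x, {U | ψ U x ≠ 0}.ncard ≤ D + 1) ∧
      ∀ U, ∃ V ∈ α, {x | ψ U x ≠ 0} ⊆ V := by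
  obtain ⟨β, hβ, hr, ho⟩ := exists_refinement hD hα
  have : Fintype β := hβ.1.fintype
  obtain ⟨ψ, hψ⟩ := PartitionOfUnity.exists_isSubordinate isClosed_univ (fun U : β => (U : Set X))
    (fun U => hβ.2.1 U U.2) (by rw [← sUnion_eq_iUnion, hβ.2.2])
  have hsub : ∀ U x, ψ U x ≠ 0 → x ∈ (U : Set X) := fun U x hx =>
    hψ U (subset_tsupport _ hx)
  refine ⟨β, this, fun U => ψ U, fun U x => ψ.nonneg U x, fun x => ?_, fun x => ?_, fun U => ?_⟩
  · rw [← finsum_eq_sum_of_fintype]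
    exact ψ.sum_eq_one (mem_univ x)
  · have h1 := coverOrder_le_iff.1 ho x
    have h2 : Set.encard {U : β | ψ U x ≠ 0} ≤ {U | U ∈ β ∧ x ∈ U}.encard := by
      rw [← Subtype.val_injective.encard_image]
      refine encard_le_encard ?_
      rintro _ ⟨U, hU, rfl⟩
      exact ⟨U.2, hsub U x hU⟩
    have h3 := h2.trans h1
    rw [← (Set.toFinite _).cast_ncard_eq] at h3
    exact_mod_cast h3
  · obtain ⟨V, hV, hUV⟩ := hr U U.2
    exact ⟨V, hV, fun x hx => hUV (hsub U x hx)⟩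

end Covers

/-- A cube-valued map on a closed subspace which is close to the restriction of `f` extends to a
map close to `f`. -/
theorem exists_extension_close {S X : Type*} [TopologicalSpace S] [TopologicalSpace X]
    [NormalSpace X] {e : S → X} (he : IsClosedEmbedding e) {m : ℕ} (f : C(X, Fin m → I))
    (g : C(S, Fin m → I)) {ε : ℝ} (hε : 0 ≤ ε) (hfg : ∀ s, dist (g s) (f (e s)) ≤ ε) :
    ∃ f' : C(X, Fin m → I), (∀ s, f' (e s) = g s) ∧ ∀ x, dist (f' x) (f x) ≤ ε := by
  -- Tietze extension is applied to the difference, which keeps the bound `ε`. Clamping the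
  -- corrected map to the cube is 1-Lipschitz and leaves cube values unchanged.
  have hH : ∀ c : Fin m, ∃ H : C(X, ℝ), (∀ x, H x ∈ Icc (-ε) ε) ∧
      ∀ s, H (e s) = (g s c : ℝ) - f (e s) c := by
    intro c
    have hc : Continuous fun s => (g s c : ℝ) - f (e s) c := by
      have := he.continuous
      fun_prop
    have hmem : ∀ s, (⟨_, hc⟩ : C(S, ℝ)) s ∈ Icc (-ε) ε := fun s => by
      have := (dist_le_pi_dist (g s) (f (e s)) c).trans (hfg s)
      rw [Subtype.dist_eq, Real.dist_eq] at this
      exact abs_le.1 this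
    obtain ⟨H, hH, hHe⟩ := ContinuousMap.exists_extension_forall_mem_of_isClosedEmbedding
      ⟨_, hc⟩ hmem ⟨0, by simpa using hε⟩ he
    exact ⟨H, hH, fun s => congrFun hHe s⟩
  choose H hH hHe using hH
  refine ⟨⟨fun x c => projIcc 0 1 zero_le_one ((f x c : ℝ) + H c x), ?_⟩, fun s => ?_, fun x => ?_⟩
  · refine continuous_pi fun c => continuous_projIcc.comp ?_
    fun_prop
  · funext c
    simp only [ContinuousMap.coe_mk, hHe, add_sub_cancel]
    exact projIcc_val _ _
  · refine (dist_pi_le_iff hε).2 fun c => ?_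
    have h := abs_projIcc_sub_projIcc (zero_le_one' ℝ) (c := (f x c : ℝ) + H c x) (d := f x c)
    rw [projIcc_val] at h
    rw [Subtype.dist_eq, Real.dist_eq]
    refine h.trans ?_
    rw [add_sub_cancel_left]
    exact abs_le.2 (hH c x)

/-! ### Perturbing maps into cubes -/

section Perturbation

/-- Finitely many continuous maps on a compact space have a common finite open cover on whose
members they oscillate little. -/
theorem exists_cover_small_oscillation {Z P M : Type*} [TopologicalSpace Z] [CompactSpace Z]
    [Finite P] [PseudoMetricSpace M] (F : P → C(Z, M)) {η : ℝ} (hη : 0 < η) :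
    ∃ α : Set (Set Z), IsFiniteOpenCover α ∧
      ∀ U ∈ α, ∀ p, ∀ x ∈ U, ∀ y ∈ U, dist (F p x) (F p y) ≤ η := by
  have ho : ∀ x : Z, IsOpen (⋂ p, {y | dist (F p y) (F p x) < η / 2}) := fun x =>
    isOpen_iInter_of_finite fun p =>
      isOpen_lt ((F p).continuous.dist continuous_const) continuous_const
  have hmem : ∀ x : Z, x ∈ ⋂ p, {y | dist (F p y) (F p x) < η / 2} := fun x =>
    mem_iInter.2 fun p => by simpa using hη
  obtain ⟨t, ht⟩ := isCompact_univ.elim_finite_subcover _ ho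
    fun x _ => mem_iUnion.2 ⟨x, hmem x⟩
  refine ⟨(fun x => ⋂ p, {y | dist (F p y) (F p x) < η / 2}) '' t,
    ⟨t.finite_toSet.image _, ?_, ?_⟩, ?_⟩
  · rintro _ ⟨x, -, rfl⟩
    exact ho x
  · refine eq_univ_of_forall fun y => ?_
    obtain ⟨x, hx, hy⟩ := mem_iUnion₂.1 (ht (mem_univ y))
    exact mem_sUnion.2 ⟨_, ⟨x, hx, rfl⟩, hy⟩
  · rintro _ ⟨x, -, rfl⟩ p y hy z hz
    have h1 : dist (F p y) (F p x) < η / 2 := mem_iInter.1 hy p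
    have h2 : dist (F p z) (F p x) < η / 2 := mem_iInter.1 hz p
    have := dist_triangle_right (F p y) (F p z) (F p x)
    linarith

variable {ι : Type*} [Fintype ι] {P : ι → Type*} [∀ a, Fintype (P a)]

theorem abs_sub_le_of_weights {J : Type*} [Fintype J] {w u : J → ℝ} (h0 : ∀ j, 0 ≤ w j)
    (h1 : ∑ j, w j = 1) {y ε : ℝ} (h : ∀ j, w j ≠ 0 → |u j - y| ≤ ε) :
    |∑ j, w j * u j - y| ≤ ε := by
  have : ∑ j, w j * u j - y = ∑ j, w j * (u j - y) := by
    simp only [mul_sub, Finset.sum_sub_distrib, ← Finset.sum_mul, h1, one_mul]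
  rw [this]
  refine (Finset.abs_sum_le_sum_abs _ _).trans ?_
  calc ∑ j, |w j * (u j - y)| ≤ ∑ j, w j * ε := by
        refine Finset.sum_le_sum fun j _ => ?_
        rw [abs_mul, abs_of_nonneg (h0 j)]
        by_cases hj : w j = 0
        · simp [hj]
        · exact mul_le_mul_of_nonneg_left (h j hj) (h0 j)
    _ = ε := by rw [← Finset.sum_mul, h1, one_mul]

/-- Cube-valued maps on low-dimensional spaces can be perturbed so that their joint values are
never invariant under a relation with few classes. -/
theorem exists_perturbation {Z : ι → Type*} [∀ a, TopologicalSpace (Z a)]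
    [∀ a, CompactSpace (Z a)] [∀ a, T2Space (Z a)] (D : ι → ℕ)
    (hZ : ∀ a, lebesgueDim (Z a) ≤ D a) (r : (Σ a, P a) → (Σ a, P a) → Prop) (m : ℕ)
    (hD : m * Nat.card (Quot r) + ∑ a, D a < m * ∑ a, Fintype.card (P a))
    (F : ∀ a, P a → C(Z a, Fin m → I)) {ε : ℝ} (hε : 0 < ε) :
    ∃ F' : ∀ a, P a → C(Z a, Fin m → I), (∀ a p z, dist (F' a p z) (F a p z) ≤ ε) ∧
      ∀ z : ∀ a, Z a, ∃ q q', r q q' ∧ F' q.1 q.2 (z q.1) ≠ F' q'.1 q'.2 (z q'.1) := by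
  -- One `η` pays for the oscillation on the cover, the other for moving the vertices.
  obtain ⟨η, hη, hη1, hηε⟩ : ∃ η : ℝ, 0 < η ∧ η ≤ 1 ∧ 2 * η ≤ ε :=
    ⟨min 1 (ε / 2), by positivity, min_le_left _ _, by linarith [min_le_right 1 (ε / 2)]⟩
  choose α hα hosc using fun a => exists_cover_small_oscillation (F a) hη
  choose β hβ ψ hψ0 hψ1 hψD hψα using fun a => exists_partitionOfUnity (hZ a) (hα a)
  have hc : ∀ a (U : β a) (p : P a), ∃ c : Fin m → I, ∀ z, ψ a U z ≠ 0 →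
      dist c (F a p z) ≤ η := by
    intro a U p
    obtain ⟨V, hV, hUV⟩ := hψα a U
    by_cases hne : ∃ z, ψ a U z ≠ 0
    · obtain ⟨z, hz⟩ := hne
      exact ⟨F a p z, fun y hy => hosc a V hV p z (hUV hz) y (hUV hy)⟩
    · push Not at hne
      exact ⟨0, fun z hz => absurd (hne z) hz⟩
  choose c hc using hc
  -- Contracting towards the centre of the cube leaves a margin `η / 2`, so the generic vertices
  -- stay in the cube, within `η` of `c`.
  obtain ⟨v, hv, hvgood⟩ := (dense_generalPosition (J := fun a => β a) r m D hD).exists_dist_lt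
    (fun a U p i => (1 - η) * (c a U p i : ℝ) + η / 2) (half_pos hη)
  have hvc : ∀ a U p i, |(1 - η) * (c a U p i : ℝ) + η / 2 - v a U p i| < η / 2 := by
    intro a U p i
    rw [← Real.dist_eq]
    set u : ∀ a, β a → P a → Fin m → ℝ := fun a U p i => (1 - η) * (c a U p i : ℝ) + η / 2
    exact lt_of_le_of_lt ((dist_le_pi_dist (u a U p) (v a U p) i).trans
      ((dist_le_pi_dist (u a U) (v a U) p).trans ((dist_le_pi_dist (u a) (v a) U).trans
        (dist_le_pi_dist u v a)))) hvgood
  have hvI : ∀ a U p i, v a U p i ∈ Icc (0 : ℝ) 1 := by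
    intro a U p i
    have h1 := abs_lt.1 (hvc a U p i)
    have h2 := (c a U p i).2.1
    have h3 := (c a U p i).2.2
    constructor <;> nlinarith
  have hvc' : ∀ a U p i, |v a U p i - c a U p i| ≤ η := by
    intro a U p i
    have h1 := abs_lt.1 (hvc a U p i)
    have h2 := (c a U p i).2.1
    have h3 := (c a U p i).2.2
    rw [abs_le]
    constructor <;> nlinarith
  have hmem : ∀ a p z i, ∑ U, ψ a U z * v a U p i ∈ Icc (0 : ℝ) 1 := by
    intro a p z i
    refine ⟨Finset.sum_nonneg fun U _ => mul_nonneg (hψ0 a U z) (hvI a U p i).1, ?_⟩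
    rw [← hψ1 a z]
    exact Finset.sum_le_sum fun U _ => mul_le_of_le_one_right (hψ0 a U z) (hvI a U p i).2
  refine ⟨fun a p => ⟨fun z i => ⟨∑ U, ψ a U z * v a U p i, hmem a p z i⟩, ?_⟩, fun a p z => ?_,
    fun z => ?_⟩
  · refine continuous_pi fun i => Continuous.subtype_mk ?_ _
    fun_prop
  · refine (dist_pi_le_iff hε.le).2 fun i => ?_
    rw [Subtype.dist_eq, Real.dist_eq]
    refine abs_sub_le_of_weights (fun U => hψ0 a U z) (hψ1 a z) fun U hU => ?_
    have h1 := (dist_le_pi_dist _ _ i).trans (hc a U p z hU)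
    rw [Subtype.dist_eq, Real.dist_eq] at h1
    have h2 := hvc' a U p i
    have h3 := abs_sub_le (v a U p i) (c a U p i) (F a p z i)
    linarith
  · obtain ⟨q, q', hr, hne⟩ := hv (fun a U => ψ a U (z a)) (fun a => hψ1 a (z a))
      (fun a => hψD a (z a))
    refine ⟨q, q', hr, fun heq => hne ?_⟩
    funext i
    have := congrArg Subtype.val (congrFun heq i)
    simpa [Finset.sum_apply] using this

end Perturbation

/-! ### Generic observables near finitely many points -/

section Local

variable {G X : Type*} [AddCommGroup G] [MetricSpace X] [AddAction G X]
  [ContinuousConstVAdd G X] {ι : Type*} [Fintype ι]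

/-- Finitely many distinct points have disjoint neighbourhoods. The disjoint union of the translated
balls then injects into `X`, so values on it can be prescribed independently. -/
theorem exists_ball_disjoint_translates (x₀ : ι → X) (P : ι → Finset G)
    (hinj : Function.Injective fun q : Σ a, P a => (q.2 : G) +ᵥ x₀ q.1) :
    ∃ δ > 0, ∀ (q q' : Σ a, P a) (z z' : X), dist z (x₀ q.1) ≤ δ → dist z' (x₀ q'.1) ≤ δ →
      (q.2 : G) +ᵥ z = (q'.2 : G) +ᵥ z' → q = q' := by
  have h : ∀ q q' : Σ a, P a, ∀ᶠ δ in 𝓝[>] (0 : ℝ), ∀ z z' : X, dist z (x₀ q.1) ≤ δ →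
      dist z' (x₀ q'.1) ≤ δ → (q.2 : G) +ᵥ z = (q'.2 : G) +ᵥ z' → q = q' := by
    intro q q'
    by_cases hq : q = q'
    · exact Eventually.of_forall fun _ _ _ _ _ _ => hq
    have ho : IsOpen {w : X × X | (q.2 : G) +ᵥ w.1 ≠ (q'.2 : G) +ᵥ w.2} :=
      isOpen_ne_fun (continuous_fst.const_vadd _) (continuous_snd.const_vadd _)
    obtain ⟨ε, hε, hb⟩ := Metric.isOpen_iff.1 ho (x₀ q.1, x₀ q'.1) fun h => hq (hinj h)
    filter_upwards [Ioo_mem_nhdsGT hε] with δ hδ z z' hz hz' he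
    have hw : (z, z') ∈ Metric.ball (x₀ q.1, x₀ q'.1) ε := by
      rw [Metric.mem_ball, Prod.dist_eq]
      exact max_lt (hz.trans_lt hδ.2) (hz'.trans_lt hδ.2)
    exact absurd he (hb hw)
  obtain ⟨δ, hδ, hpos⟩ := ((eventually_all.2 fun q => eventually_all.2 (h q)).and
    self_mem_nhdsWithin).exists
  exact ⟨δ, hpos, hδ⟩

/-- If the translates `p x₀ a` (`p ∈ P a`) are pairwise different, and `r` is a relation with few
classes, then the values of a generic `f` at the translates of points `z a ∈ Y a` near `x₀ a`
are not invariant under `r`. -/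
theorem exists_ball_residual [CompactSpace X] (x₀ : ι → X) (P : ι → Finset G)
    (hinj : Function.Injective fun q : Σ a, P a => (q.2 : G) +ᵥ x₀ q.1)
    (Y : ι → Set X) (hY : ∀ a, IsClosed (Y a)) (D : ι → ℕ) (hYD : ∀ a, lebesgueDim (Y a) ≤ D a)
    (r : (Σ a, P a) → (Σ a, P a) → Prop) (m : ℕ)
    (hD : m * Nat.card (Quot r) + ∑ a, D a < m * ∑ a, (P a).card) :
    ∃ δ > 0, {f : C(X, Fin m → I) | ∀ z : ι → X, (∀ a, z a ∈ Y a ∧ dist (z a) (x₀ a) ≤ δ) →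
      ∃ q q', r q q' ∧ f ((q.2 : G) +ᵥ z q.1) ≠ f ((q'.2 : G) +ᵥ z q'.1)} ∈
        residual C(X, Fin m → I) := by
  obtain ⟨δ, hδ, hdisj⟩ := exists_ball_disjoint_translates x₀ P hinj
  refine ⟨δ, hδ, ?_⟩
  set K : ι → Set X := fun a => Y a ∩ Metric.closedBall (x₀ a) δ with hK
  have hKc : ∀ a, IsCompact (K a) := fun a => ((hY a).inter Metric.isClosed_closedBall).isCompact
  have : ∀ a, CompactSpace (K a) := fun a => isCompact_iff_compactSpace.1 (hKc a)
  have hKD : ∀ a, lebesgueDim (K a) ≤ D a := fun a =>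
    (lebesgueDim_le_of_isClosedEmbedding
      ((continuous_inclusion inter_subset_left).isClosedEmbedding
        (inclusion_injective (inter_subset_left : K a ⊆ Y a)))).trans (hYD a)
  refine residual_of_dense_open ?_ ?_
  · rw [isOpen_iff_eventually]
    intro f hf
    -- Openness: the tuples range over a compact set, and each inequality persists near a given
    -- observable and tuple.
    have hcpt : IsCompact {z : ι → X | ∀ a, z a ∈ Y a ∧ dist (z a) (x₀ a) ≤ δ} := by
      convert isCompact_univ_pi hKc using 1
      ext z
      simp [hK]
    refine hcpt.eventually_forall_of_forall_eventually
      (P := fun (f : C(X, Fin m → I)) (z : ι → X) => ∃ q q' : Σ a, P a, r q q' ∧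
        f ((q.2 : G) +ᵥ z q.1) ≠ f ((q'.2 : G) +ᵥ z q'.1)) fun z hz => ?_
    obtain ⟨q, q', hr, hne⟩ := hf z hz
    have hev : ∀ q : Σ a, P a, Continuous fun w : C(X, Fin m → I) × (ι → X) =>
        w.1 ((q.2 : G) +ᵥ w.2 q.1) := fun q =>
      continuous_eval.comp (continuous_fst.prodMk
        (((continuous_apply q.1).comp continuous_snd).const_vadd (q.2 : G)))
    filter_upwards [(isOpen_ne_fun (hev q) (hev q')).mem_nhds hne] with w hw
    exact ⟨q, q', hr, hw⟩
  · rw [Metric.dense_iff]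
    intro f ε hε
    -- Density: perturb on the disjoint union of the translates, then extend to `X`.
    set e : (Σ q : (Σ a, P a), K q.1) → X := fun s => (s.1.2 : G) +ᵥ (s.2 : X) with he
    have hec : Continuous e := continuous_sigma fun q =>
      (continuous_subtype_val (p := (· ∈ K q.1))).const_vadd (q.2 : G)
    have hei : Function.Injective e := by
      rintro ⟨q, z⟩ ⟨q', z'⟩ h
      obtain rfl : q = q' := hdisj q q' z z' z.2.2 z'.2.2 h
      have : z = z' := Subtype.ext (vadd_left_cancel _ h)
      rw [this]
    obtain ⟨F', hF', hsep⟩ := exists_perturbation (P := fun a => P a) D hKD r m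
      (by simpa only [Fintype.card_coe] using hD)
      (fun a p => ⟨fun z => f ((p : G) +ᵥ (z : X)),
        f.continuous.comp (continuous_subtype_val.const_vadd _)⟩) (half_pos hε)
    obtain ⟨f', hf', hclose⟩ := exists_extension_close (hec.isClosedEmbedding hei) f
      ⟨fun s => F' s.1.1 s.1.2 s.2, continuous_sigma fun q => (F' q.1 q.2).continuous⟩
      (half_pos hε).le (fun s => hF' _ _ _)
    refine ⟨f', ?_, fun z hz => ?_⟩
    · rw [Metric.mem_ball]
      exact lt_of_le_of_lt ((ContinuousMap.dist_le (half_pos hε).le).2 hclose) (half_lt_self hε)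
    · obtain ⟨q, q', hr, hne⟩ := hsep fun a => ⟨z a, hz a⟩
      refine ⟨q, q', hr, ?_⟩
      have h : ∀ q : Σ a, P a, f' ((q.2 : G) +ᵥ z q.1) = F' q.1 q.2 ⟨z q.1, hz q.1⟩ := fun q =>
        hf' ⟨q, ⟨z q.1, hz q.1⟩⟩
      rw [h, h]
      exact hne

end Local

/-! ### Counting classes and choosing representatives -/

section Relations

/-- Every element has a different partner in its class, so no class is a singleton. -/
theorem two_mul_card_quot_le {Q : Type*} [Finite Q] (r : Q → Q → Prop)
    (h : ∀ q, ∃ q', q ≠ q' ∧ (r q q' ∨ r q' q)) : 2 * Nat.card (Quot r) ≤ Nat.card Q := by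
  classical
  have := Fintype.ofFinite Q
  have := Fintype.ofFinite (Quot r)
  have him : Finset.univ.image (Quot.mk r) = Finset.univ :=
    Finset.image_univ_of_surjective Quot.mk_surjective
  rw [Nat.card_eq_fintype_card, Nat.card_eq_fintype_card, ← Finset.card_univ, ← Finset.card_univ,
    ← him]
  refine Finset.mul_card_image_le_card _ _ fun c _ => ?_
  obtain ⟨q, rfl⟩ := Quot.mk_surjective c
  obtain ⟨q', hne, hr⟩ := h q
  have hq : Quot.mk r q' = Quot.mk r q := hr.elim (fun h => (Quot.sound h).symm) Quot.sound
  rw [← Finset.card_pair hne]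
  refine Finset.card_le_card ?_
  intro s hs
  rcases Finset.mem_insert.1 hs with rfl | hs
  · simp
  · rw [Finset.mem_singleton.1 hs]
    simpa using hq

/-- Choose one element of `B` in each coset that meets `B`. For `A` a stabilizer, distinct
representatives move the point to distinct places. -/
theorem exists_representatives {G : Type*} [AddCommGroup G] (A : AddSubgroup G) (B : Finset G) :
    ∃ ρ : G → G, (∀ i ∈ B, ρ i ∈ B) ∧ (∀ i ∈ B, i - ρ i ∈ A) ∧
      ∀ i ∈ B, ∀ i' ∈ B, ρ i - ρ i' ∈ A → ρ i = ρ i' := by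
  have hmk : ∀ i i' : G, (i : G ⧸ A) = i' ↔ i' - i ∈ A := fun i i' => by
    rw [QuotientAddGroup.eq, neg_add_eq_sub]
  have hmem : ∀ i ∈ B, (i : G ⧸ A) ∈ ((↑) : G → G ⧸ A) '' (B : Set G) := fun i hi => ⟨i, hi, rfl⟩
  have hρ : ∀ i ∈ B, ((Function.invFunOn ((↑) : G → G ⧸ A) (B : Set G) (i : G ⧸ A) : G) : G ⧸ A)
      = i := fun i hi => Function.invFunOn_eq (hmem i hi)
  refine ⟨fun i => Function.invFunOn ((↑) : G → G ⧸ A) (B : Set G) (i : G ⧸ A),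
    fun i hi => Function.invFunOn_mem (hmem i hi), fun i hi => (hmk _ _).1 (hρ i hi),
    fun i hi i' hi' h => ?_⟩
  have h' := (hmk _ _).2 h
  rw [hρ i hi, hρ i' hi'] at h'
  simp only [h']

end Relations

/-! ### Subgroups, boxes and dimensions of sets of periodic points -/

section Boxes

variable {k : ℕ}

/-- The box `[a, b]^k` in `ℤ^k`. -/
noncomputable def box (k : ℕ) (a b : ℤ) : Finset (Fin k → ℤ) := Finset.Icc (fun _ => a) (fun _ => b)

theorem mem_box {a b : ℤ} {i : Fin k → ℤ} : i ∈ box k a b ↔ ∀ c, a ≤ i c ∧ i c ≤ b := by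
  simp [box, Finset.mem_Icc, Pi.le_def, forall_and]

/-- If a subgroup contains a small positive multiple of every unit vector, then the box contains
representatives of all of its cosets. -/
theorem exists_mem_box_sub_mem {N : ℕ} {S : AddSubgroup (Fin k → ℤ)} {n : Fin k → ℤ}
    (hn : ∀ c, 0 < n c ∧ n c ≤ N) (hS : ∀ c, Pi.single c (n c) ∈ S) (g : Fin k → ℤ) :
    (fun c => g c % n c) ∈ box k 0 N ∧ g - (fun c => g c % n c) ∈ S := by
  refine ⟨mem_box.2 fun c => ⟨Int.emod_nonneg _ (hn c).1.ne', ?_⟩, ?_⟩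
  · exact (Int.emod_lt_of_pos _ (hn c).1).le.trans (hn c).2
  · have : g - (fun c => g c % n c) = ∑ c, (g c / n c) • (Pi.single c (n c) : Fin k → ℤ) := by
      rw [← Finset.univ_sum_single (g - fun c => g c % n c)]
      refine Finset.sum_congr rfl fun c _ => ?_
      rw [← Pi.single_smul]
      congr 1
      simp only [Pi.sub_apply, smul_eq_mul]
      linarith [Int.emod_add_mul_ediv (g c) (n c), mul_comm (n c) (g c / n c)]
    rw [this]
    exact S.sum_mem fun c _ => S.zsmul_mem (hS c) _

theorem lebesgueDim_le_of_isClosed {X : Type*} [TopologicalSpace X] {Y : Set X} (hY : IsClosed Y) :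
    lebesgueDim Y ≤ lebesgueDim X :=
  lebesgueDim_le_of_isClosedEmbedding hY.isClosedEmbedding_subtypeVal

variable {X : Type*} [MetricSpace X] [AddAction (Fin k → ℤ) X]
  [ContinuousConstVAdd (Fin k → ℤ) X]

theorem isClosed_setOf_forall_vadd_eq (p : (Fin k → ℤ) → Prop) :
    IsClosed {x : X | ∀ b, p b → b +ᵥ x = x} := by
  simp only [ofPred_forall]
  exact isClosed_iInter fun b => isClosed_iInter fun _ =>
    isClosed_eq (continuous_id.const_vadd b) continuous_id

variable [CompactSpace X]

theorem lebesgueDim_mono {Y Z : Set X} (hY : IsClosed Y) (h : Y ⊆ Z) :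
    lebesgueDim Y ≤ lebesgueDim Z := by
  have := isCompact_iff_compactSpace.1 hY.isCompact
  exact lebesgueDim_le_of_isClosedEmbedding
    ((continuous_inclusion h).isClosedEmbedding (inclusion_injective h))

/-- The closed set of all points with at least the periods of `A` in a large box has small
dimension compared to the number of classes modulo `A` in the box. -/
theorem exists_lebesgueDim_le {d m N : ℕ} (hm : 1 ≤ m) (hX : lebesgueDim X = d) (hN : 2 * d ≤ N)
    (hA : ∀ A : AddSubgroup (Fin k → ℤ), A.index ≠ 0 → A.index ≤ 2 * d →
      ((lebesgueDim (fixedSet X A) : ℕ∞) : ℝ≥0∞) / (A.index : ℝ≥0∞) < (m : ℝ≥0∞) / 2)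
    (A : AddSubgroup (Fin k → ℤ)) (P : Finset (Fin k → ℤ))
    (hP : ∀ i ∈ box k 0 (2 * d : ℕ), ∃ p ∈ P, i - p ∈ A) :
    ∃ D : ℕ, lebesgueDim {x : X | ∀ b, b ∈ box k (-N) N ∧ b ∈ A → b +ᵥ x = x} ≤ D ∧
      2 * D < m * P.card := by
  have hYc := isClosed_setOf_forall_vadd_eq (X := X) fun b => b ∈ box k (-N) N ∧ b ∈ A
  have hlarge : 2 * d + 1 ≤ P.card → ∃ D : ℕ,
      lebesgueDim {x : X | ∀ b, b ∈ box k (-N) N ∧ b ∈ A → b +ᵥ x = x} ≤ D ∧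
        2 * D < m * P.card := fun h =>
    ⟨d, hX ▸ lebesgueDim_le_of_isClosed hYc, by nlinarith⟩
  by_cases hinj : ∃ c : Fin k, ∀ n : ℤ, 0 < n → n ≤ (2 * d : ℕ) →
      (Pi.single c n : Fin k → ℤ) ∉ A
  · obtain ⟨c, hc⟩ := hinj
    apply hlarge
    -- The multiples `0, …, 2 * d` of the unit vector in direction `c` are pairwise incongruent
    -- modulo `A`.
    have hbox : ∀ t : Fin (2 * d + 1),
        (Pi.single c ((t : ℕ) : ℤ) : Fin k → ℤ) ∈ box k 0 (2 * d : ℕ) := fun t => by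
      have := t.2
      refine mem_box.2 fun c' => ?_
      by_cases h : c' = c
      · subst h
        simp only [Pi.single_eq_same]
        omega
      · simp only [Pi.single_eq_of_ne h]
        omega
    choose φ hφP hφA using fun t => hP _ (hbox t)
    have hlt : ∀ t t' : Fin (2 * d + 1), t < t' → φ t ≠ φ t' := fun t t' htt h => by
      have h1 := A.sub_mem (hφA t') (hφA t)
      rw [h, sub_sub_sub_cancel_right, ← Pi.single_sub] at h1
      have := t'.2
      have h2 : (t : ℕ) < t' := htt
      exact hc _ (by omega) (by omega) h1
    have hφ : Function.Injective φ := fun t t' h => by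
      by_contra hne
      rcases lt_or_gt_of_ne hne with h' | h'
      · exact hlt _ _ h' h
      · exact hlt _ _ h' h.symm
    have := Finset.card_le_card_of_injOn (s := Finset.univ) φ (fun t _ => hφP t) hφ.injOn
    simpa using this
  · push Not at hinj
    choose n hn0 hnd hnA using hinj
    have hred := exists_mem_box_sub_mem (N := 2 * d) (fun c => ⟨hn0 c, hnd c⟩) hnA
    have hsurj : Function.Surjective fun p : P => ((p : Fin k → ℤ) : (Fin k → ℤ) ⧸ A) := by
      intro q
      obtain ⟨g, rfl⟩ := QuotientAddGroup.mk_surjective q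
      obtain ⟨hb, hs⟩ := hred g
      obtain ⟨p, hp, hpA⟩ := hP _ hb
      refine ⟨⟨p, hp⟩, ?_⟩
      simp only [QuotientAddGroup.eq, neg_add_eq_sub]
      simpa using A.add_mem hs hpA
    have hfin : Finite ((Fin k → ℤ) ⧸ A) := Finite.of_surjective _ hsurj
    have hidx0 : A.index ≠ 0 := AddSubgroup.index_ne_zero_of_finite
    have hidxP : A.index ≤ P.card := by
      have := Nat.card_le_card_of_surjective _ hsurj
      simpa [AddSubgroup.index] using this
    rcases Nat.lt_or_ge (2 * d) A.index with hlt | hle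
    · exact hlarge (by omega)
    -- `A` is generated by its elements in the box: reducing modulo the vectors `Pi.single c (n c)`
    -- leaves a remainder in the box and in `A`.
    have hYA : {x : X | ∀ b, b ∈ box k (-N) N ∧ b ∈ A → b +ᵥ x = x} ⊆ fixedSet X A := by
      intro x hx a ha
      have hbig : ∀ b ∈ box k 0 (2 * d : ℕ), b ∈ A → b ∈ AddAction.stabilizer (Fin k → ℤ) x :=
        fun b hb hbA => hx b ⟨mem_box.2 fun c => by
          have := mem_box.1 hb c
          omega, hbA⟩
      have hsingle : ∀ c, (Pi.single c (n c) : Fin k → ℤ) ∈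
          AddAction.stabilizer (Fin k → ℤ) x := fun c => hbig _ (mem_box.2 fun c' => by
            have := hn0 c
            have := hnd c
            by_cases h : c' = c
            · subst h
              simp only [Pi.single_eq_same]
              omega
            · simp only [Pi.single_eq_of_ne h]
              omega) (hnA c)
      obtain ⟨hb, hs⟩ := hred a
      obtain ⟨-, hs'⟩ := exists_mem_box_sub_mem (N := 2 * d) (fun c => ⟨hn0 c, hnd c⟩) hsingle a
      have h1 := hbig _ hb (by simpa using A.sub_mem ha hs)
      have h2 := AddSubgroup.add_mem _ hs' h1
      rwa [sub_add_cancel] at h2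
    have hfix : lebesgueDim (fixedSet X A) ≤ d :=
      hX ▸ lebesgueDim_le_of_isClosed (isClosed_setOf_forall_vadd_eq (X := X) fun b => b ∈ A)
    obtain ⟨D, hD⟩ := ENat.ne_top_iff_exists.1 (ne_top_of_le_ne_top (ENat.natCast_ne_top d) hfix)
    refine ⟨D, (lebesgueDim_mono hYc hYA).trans hD.ge, ?_⟩
    have h := hA A hidx0 hle
    rw [← hD, ENNReal.div_lt_iff (Or.inl (by exact_mod_cast hidx0))
      (Or.inl (ENNReal.natCast_ne_top _)), ENNReal.mul_comm_div, ← mul_div_assoc,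
      ENNReal.lt_div_iff_mul_lt (Or.inl (by simp)) (Or.inl (by simp))] at h
    have h' : D * 2 < m * A.index := by exact_mod_cast h
    nlinarith

end Boxes

/-! ### Separating pairs of points -/

section Separation

variable {k : ℕ} {X : Type*} [AddAction (Fin k → ℤ) X]

open Classical in
/-- The coincidences, within the box `[-N, N]^k`, of the orbits of two points. -/
noncomputable def orbitPattern (N : ℕ) (w : X × X) :
    Finset (Fin k → ℤ) × Finset (Fin k → ℤ) × Finset (Fin k → ℤ) :=
  ((box k (-N) N).filter fun b => b +ᵥ w.1 = w.1, (box k (-N) N).filter fun b => b +ᵥ w.2 = w.2,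
    (box k (-N) N).filter fun b => b +ᵥ w.1 = w.2)

theorem orbitPattern_eq {N : ℕ} {w w' : X × X}
    (h : orbitPattern (k := k) N w = orbitPattern N w') {b : Fin k → ℤ} (hb : b ∈ box k (-N) N) :
    (b +ᵥ w.1 = w.1 ↔ b +ᵥ w'.1 = w'.1) ∧ (b +ᵥ w.2 = w.2 ↔ b +ᵥ w'.2 = w'.2) ∧
      (b +ᵥ w.1 = w.2 ↔ b +ᵥ w'.1 = w'.2) := by
  simp only [orbitPattern, Prod.mk.injEq, Finset.filter_inj'] at h
  exact ⟨h.1 hb, h.2.1 hb, h.2.2 hb⟩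

theorem vadd_eq_vadd_of_sub {G Y : Type*} [AddCommGroup G] [AddAction G Y] {i i' : G} {x : Y}
    (h : (i - i') +ᵥ x = x) :
    i +ᵥ x = i' +ᵥ x := by
  rw [← sub_add_cancel i i', add_comm, add_vadd, h]

theorem sub_mem_stabilizer {G Y : Type*} [AddCommGroup G] [AddAction G Y] {i i' : G} {x : Y}
    (h : i +ᵥ x = i' +ᵥ x) : i - i' ∈ AddAction.stabilizer G x := by
  rw [AddAction.mem_stabilizer_iff, sub_eq_neg_add, add_vadd, h, neg_vadd_vadd]

variable [MetricSpace X] [CompactSpace X] [ContinuousConstVAdd (Fin k → ℤ) X]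

/-- Near a pair `(x, j x)` of different points of one orbit, a generic observable separates the
pairs `(z, j z)` for which `z` has at least the periods of `x`. -/
theorem exists_ball_separated_same_orbit {d m : ℕ} (hm : 1 ≤ m) (hX : lebesgueDim X = d)
    (hA : ∀ A : AddSubgroup (Fin k → ℤ), A.index ≠ 0 → A.index ≤ 2 * d →
      ((lebesgueDim (fixedSet X A) : ℕ∞) : ℝ≥0∞) / (A.index : ℝ≥0∞) < (m : ℝ≥0∞) / 2)
    {x : X} {j : Fin k → ℤ} (hj : j ∈ box k (-(2 * d : ℕ)) (2 * d : ℕ)) (hjx : j +ᵥ x ≠ x) :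
    ∃ δ > 0, {f : C(X, Fin m → I) | ∀ z : X,
      (∀ b ∈ box k (-(8 * d : ℕ)) (8 * d : ℕ), b +ᵥ x = x → b +ᵥ z = z) → dist z x ≤ δ →
      ∃ i ∈ box k 0 (2 * d : ℕ), f (i +ᵥ z) ≠ f (i +ᵥ (j +ᵥ z))} ∈ residual C(X, Fin m → I) := by
  classical
  set A := AddAction.stabilizer (Fin k → ℤ) x with hAdef
  set B := box k 0 (2 * d : ℕ) ∪ (box k 0 (2 * d : ℕ)).image fun i => i + j with hB
  have hB1 : ∀ i ∈ box k 0 (2 * d : ℕ), i ∈ B := fun i hi => Finset.mem_union_left _ hi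
  have hB2 : ∀ i ∈ box k 0 (2 * d : ℕ), i + j ∈ B := fun i hi =>
    Finset.mem_union_right _ (Finset.mem_image_of_mem (fun i => i + j) hi)
  have hBbox : ∀ i ∈ B, i ∈ box k (-(2 * d : ℕ)) (4 * d : ℕ) := by
    intro i hi
    rcases Finset.mem_union.1 hi with hi | hi
    · refine mem_box.2 fun c => ?_
      have := mem_box.1 hi c
      omega
    · obtain ⟨i₀, hi₀, rfl⟩ := Finset.mem_image.1 hi
      refine mem_box.2 fun c => ?_
      have := mem_box.1 hi₀ c
      have := mem_box.1 hj c
      simp only [Pi.add_apply]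
      omega
  -- This is why periods are recorded up to `8 * d`: coordinates in `B` lie between `-2 * d` and `4
  -- * d`, so differences are at most `6 * d` in absolute value.
  have hsub : ∀ i ∈ B, ∀ i' ∈ B, i - i' ∈ box k (-(8 * d : ℕ)) (8 * d : ℕ) := by
    intro i hi i' hi'
    refine mem_box.2 fun c => ?_
    have := mem_box.1 (hBbox i hi) c
    have := mem_box.1 (hBbox i' hi') c
    simp only [Pi.sub_apply]
    omega
  obtain ⟨ρ, hρB, hρA, hρ⟩ := exists_representatives A B
  set P := B.image ρ with hP
  have hPm : ∀ i ∈ B, ρ i ∈ P := fun i hi => Finset.mem_image_of_mem ρ hi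
  obtain ⟨D, hD, hDP⟩ := exists_lebesgueDim_le (N := 8 * d) hm hX (by omega) hA A P
    (fun i hi => ⟨ρ i, hPm i (hB1 i hi), hρA i (hB1 i hi)⟩)
  -- The relation encodes `f (i +ᵥ z) = f (i +ᵥ (j +ᵥ z))` through representatives. The two ends
  -- always differ because `j` does not fix `x`.
  set r : (Σ _ : Unit, P) → (Σ _ : Unit, P) → Prop := fun q q' =>
    ∃ i ∈ box k 0 (2 * d : ℕ), (q.2 : Fin k → ℤ) = ρ i ∧ (q'.2 : Fin k → ℤ) = ρ (i + j) with hr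
  have hne : ∀ i ∈ box k 0 (2 * d : ℕ), ρ i ≠ ρ (i + j) := by
    intro i hi h
    have h1 := A.sub_mem (hρA _ (hB2 i hi)) (hρA _ (hB1 i hi))
    rw [h, sub_sub_sub_cancel_right, add_sub_cancel_left] at h1
    exact hjx h1
  have hquot : 2 * Nat.card (Quot r) ≤ P.card := by
    refine (two_mul_card_quot_le r ?_).trans (by simp)
    rintro ⟨⟨⟩, p, hp⟩
    obtain ⟨i, hi, rfl⟩ := Finset.mem_image.1 hp
    rcases Finset.mem_union.1 hi with hi' | hi'
    · refine ⟨⟨(), ρ (i + j), hPm _ (hB2 i hi')⟩, fun h => hne i hi' ?_, Or.inl ⟨i, hi', rfl, rfl⟩⟩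
      exact congrArg (fun q : Σ _ : Unit, P => (q.2 : Fin k → ℤ)) h
    · obtain ⟨i₀, hi₀, rfl⟩ := Finset.mem_image.1 hi'
      refine ⟨⟨(), ρ i₀, hPm _ (hB1 i₀ hi₀)⟩, fun h => hne i₀ hi₀ ?_, Or.inr ⟨i₀, hi₀, rfl, rfl⟩⟩
      exact (congrArg (fun q : Σ _ : Unit, P => (q.2 : Fin k → ℤ)) h).symm
  have hinj : Function.Injective fun q : Σ _ : Unit, P => (q.2 : Fin k → ℤ) +ᵥ x := by
    rintro ⟨⟨⟩, p, hp⟩ ⟨⟨⟩, p', hp'⟩ h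
    obtain ⟨i, hi, rfl⟩ := Finset.mem_image.1 hp
    obtain ⟨i', hi', rfl⟩ := Finset.mem_image.1 hp'
    have := hρ i hi i' hi' (sub_mem_stabilizer h)
    simp only [this]
  obtain ⟨δ, hδ, hres⟩ := exists_ball_residual (fun _ : Unit => x) (fun _ => P) hinj
    (fun _ => {x : X | ∀ b, b ∈ box k (-(8 * d : ℕ)) (8 * d : ℕ) ∧ b ∈ A → b +ᵥ x = x})
    (fun _ => isClosed_setOf_forall_vadd_eq _) (fun _ => D) (fun _ => hD) r m
    (by simp only [Finset.univ_unique, Finset.sum_const, Finset.card_singleton, one_smul]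
        nlinarith)
  · refine ⟨δ, hδ, mem_of_superset hres fun f hf z hz hzx => ?_⟩
    obtain ⟨q, q', ⟨i, hi, hq, hq'⟩, hfne⟩ := hf (fun _ => z)
      fun _ => ⟨fun b hb => hz b hb.1 hb.2, hzx⟩
    refine ⟨i, hi, ?_⟩
    have hmove : ∀ i ∈ B, i +ᵥ z = ρ i +ᵥ z := fun i hi =>
      vadd_eq_vadd_of_sub (hz _ (hsub _ hi _ (hρB i hi)) (hρA i hi))
    rw [hmove i (hB1 i hi), ← add_vadd, hmove _ (hB2 i hi), ← hq, ← hq']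
    exact hfne

/-- Near a pair of points whose orbit segments are disjoint, a generic observable separates the
pairs of points which have at least the same periods. -/
theorem exists_ball_separated_of_disjoint {d m : ℕ} (hm : 1 ≤ m) (hX : lebesgueDim X = d)
    (hA : ∀ A : AddSubgroup (Fin k → ℤ), A.index ≠ 0 → A.index ≤ 2 * d →
      ((lebesgueDim (fixedSet X A) : ℕ∞) : ℝ≥0∞) / (A.index : ℝ≥0∞) < (m : ℝ≥0∞) / 2)
    {x : Bool → X} (hx : ∀ j ∈ box k (-(2 * d : ℕ)) (2 * d : ℕ), j +ᵥ x true ≠ x false) :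
    ∃ δ > 0, {f : C(X, Fin m → I) | ∀ z : Bool → X,
      (∀ a, (∀ b ∈ box k (-(8 * d : ℕ)) (8 * d : ℕ), b +ᵥ x a = x a → b +ᵥ z a = z a) ∧
        dist (z a) (x a) ≤ δ) →
      ∃ i ∈ box k 0 (2 * d : ℕ), f (i +ᵥ z true) ≠ f (i +ᵥ z false)} ∈
        residual C(X, Fin m → I) := by
  classical
  set B := box k 0 (2 * d : ℕ) with hB
  have hsub : ∀ i ∈ B, ∀ i' ∈ B, i - i' ∈ box k (-(2 * d : ℕ)) (2 * d : ℕ) := by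
    intro i hi i' hi'
    refine mem_box.2 fun c => ?_
    have := mem_box.1 hi c
    have := mem_box.1 hi' c
    simp only [Pi.sub_apply]
    omega
  have hsub' : ∀ i ∈ B, ∀ i' ∈ B, i - i' ∈ box k (-(8 * d : ℕ)) (8 * d : ℕ) := by
    intro i hi i' hi'
    refine mem_box.2 fun c => ?_
    have := mem_box.1 (hsub i hi i' hi') c
    omega
  choose ρ hρB hρA hρ using fun a : Bool =>
    exists_representatives (AddAction.stabilizer (Fin k → ℤ) (x a)) B
  set P : Bool → Finset (Fin k → ℤ) := fun a => B.image (ρ a) with hP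
  have hPm : ∀ a, ∀ i ∈ B, ρ a i ∈ P a := fun a i hi => Finset.mem_image_of_mem (ρ a) hi
  choose D hD hDP using fun a : Bool => exists_lebesgueDim_le (N := 8 * d) hm hX (by omega) hA
    (AddAction.stabilizer (Fin k → ℤ) (x a)) (P a) (fun i hi => ⟨ρ a i, hPm a i hi, hρA a i hi⟩)
  set r : (Σ a : Bool, P a) → (Σ a : Bool, P a) → Prop := fun q q' =>
    ∃ i, ∃ hi : i ∈ B, q = ⟨true, ρ true i, hPm true i hi⟩ ∧ q' = ⟨false, ρ false i, hPm false i hi⟩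
    with hr
  -- Each class meets both orbits, so either set of representatives bounds the number of classes.
  have hquot : ∀ a, Nat.card (Quot r) ≤ (P a).card := by
    intro a
    have hsurj : Function.Surjective fun p : P a => Quot.mk r ⟨a, p⟩ := by
      intro c
      obtain ⟨⟨a', p, hp⟩, rfl⟩ := Quot.mk_surjective c
      obtain ⟨i, hi, rfl⟩ := Finset.mem_image.1 hp
      refine ⟨⟨ρ a i, hPm a i hi⟩, ?_⟩
      have hs := Quot.sound (r := r) (⟨i, hi, rfl, rfl⟩ :
        r ⟨true, ρ true i, hPm true i hi⟩ ⟨false, ρ false i, hPm false i hi⟩)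
      cases a <;> cases a'
      · rfl
      · exact hs.symm
      · exact hs
      · rfl
    simpa using Nat.card_le_card_of_surjective _ hsurj
  have hinj : Function.Injective fun q : Σ a : Bool, P a => (q.2 : Fin k → ℤ) +ᵥ x q.1 := by
    have hdisj : ∀ i ∈ B, ∀ i' ∈ B, ρ true i +ᵥ x true ≠ ρ false i' +ᵥ x false := by
      intro i hi i' hi' h
      refine hx _ (hsub _ (hρB true i hi) _ (hρB false i' hi')) ?_
      rw [sub_eq_neg_add, add_vadd, h, neg_vadd_vadd]
    rintro ⟨a, p, hp⟩ ⟨a', p', hp'⟩ h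
    obtain ⟨i, hi, rfl⟩ := Finset.mem_image.1 hp
    obtain ⟨i', hi', rfl⟩ := Finset.mem_image.1 hp'
    by_cases haa : a = a'
    · subst haa
      have := hρ a i hi i' hi' (sub_mem_stabilizer h)
      simp only [this]
    · cases a <;> cases a'
      · exact absurd rfl haa
      · exact absurd h.symm (hdisj i' hi' i hi)
      · exact absurd h (hdisj i hi i' hi')
      · exact absurd rfl haa
  obtain ⟨δ, hδ, hres⟩ := exists_ball_residual x P hinj
    (fun a => {z : X | ∀ b, b ∈ box k (-(8 * d : ℕ)) (8 * d : ℕ) ∧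
      b ∈ AddAction.stabilizer (Fin k → ℤ) (x a) → b +ᵥ z = z})
    (fun _ => isClosed_setOf_forall_vadd_eq _) D hD r m
    (by have h1 := Nat.mul_le_mul_left m (hquot true)
        have h2 := Nat.mul_le_mul_left m (hquot false)
        have h3 := hDP true
        have h4 := hDP false
        simp only [Fintype.univ_bool, Finset.sum_pair (Bool.true_eq_false_eq_False), mul_add]
        omega)
  · refine ⟨δ, hδ, mem_of_superset hres fun f hf z hz => ?_⟩
    obtain ⟨q, q', ⟨i, hi, rfl, rfl⟩, hfne⟩ := hf z
      fun a => ⟨fun b hb => (hz a).1 b hb.1 hb.2, (hz a).2⟩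
    have hmove : ∀ a, i +ᵥ z a = ρ a i +ᵥ z a := fun a =>
      vadd_eq_vadd_of_sub ((hz a).1 _ (hsub' _ hi _ (hρB a i hi)) (hρA a i hi))
    exact ⟨i, hi, by rw [hmove, hmove]; exact hfne⟩

/-- Every pair of different points has a neighbourhood, within the set of pairs with the same orbit
pattern, all of whose members are separated by the delay map of a generic observable. -/
theorem exists_nhdsWithin_separated {d m : ℕ} (hm : 1 ≤ m) (hX : lebesgueDim X = d)
    (hA : ∀ A : AddSubgroup (Fin k → ℤ), A.index ≠ 0 → A.index ≤ 2 * d →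
      ((lebesgueDim (fixedSet X A) : ℕ∞) : ℝ≥0∞) / (A.index : ℝ≥0∞) < (m : ℝ≥0∞) / 2)
    (w : X × X) (hw : w.1 ≠ w.2) :
    ∃ W ∈ 𝓝[{w' | orbitPattern (k := k) (8 * d) w' = orbitPattern (8 * d) w}] w,
      {f : C(X, Fin m → I) | ∀ w' ∈ W, ∃ i ∈ box k 0 (2 * d : ℕ),
        f (i +ᵥ w'.1) ≠ f (i +ᵥ w'.2)} ∈ residual C(X, Fin m → I) := by
  suffices h : ∃ δ > 0, {f : C(X, Fin m → I) | ∀ w' : X × X,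
      orbitPattern (k := k) (8 * d) w' = orbitPattern (8 * d) w → dist w' w ≤ δ →
      ∃ i ∈ box k 0 (2 * d : ℕ), f (i +ᵥ w'.1) ≠ f (i +ᵥ w'.2)} ∈ residual C(X, Fin m → I) by
    obtain ⟨δ, hδ, hres⟩ := h
    exact ⟨_, inter_mem_nhdsWithin _ (Metric.closedBall_mem_nhds w hδ),
      mem_of_superset hres fun f hf w' hw' => hf w' hw'.1 hw'.2⟩
  by_cases hj : ∃ j ∈ box k (-(2 * d : ℕ)) (2 * d : ℕ), j +ᵥ w.1 = w.2
  · obtain ⟨j, hj, hjw⟩ := hj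
    obtain ⟨δ, hδ, hres⟩ := exists_ball_separated_same_orbit hm hX hA (x := w.1) hj
      (by rw [hjw]; exact hw.symm)
    refine ⟨δ, hδ, mem_of_superset hres fun f hf w' hw' hd => ?_⟩
    have hjw' : j +ᵥ w'.1 = w'.2 := ((orbitPattern_eq hw' (mem_box.2 fun c => by
      have := mem_box.1 hj c
      omega)).2.2).2 hjw
    rw [← hjw']
    exact hf w'.1 (fun b hb => (orbitPattern_eq hw' hb).1.2) ((le_max_left _ _).trans hd)
  · push Not at hj
    obtain ⟨δ, hδ, hres⟩ := exists_ball_separated_of_disjoint hm hX hA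
      (x := fun a => cond a w.1 w.2) hj
    refine ⟨δ, hδ, mem_of_superset hres fun f hf w' hw' hd => ?_⟩
    refine hf (fun a => cond a w'.1 w'.2) fun a => ?_
    cases a
    · exact ⟨fun b hb => (orbitPattern_eq hw' hb).2.1.2, (le_max_right _ _).trans hd⟩
    · exact ⟨fun b hb => (orbitPattern_eq hw' hb).1.2, (le_max_left _ _).trans hd⟩

/-- The local conditions are countable in number: there are countably many patterns, and each set of
pairs with a fixed pattern is Lindelöf. -/
theorem residual_isEmbedding_delayMap {d m : ℕ} (hm : 1 ≤ m) (hX : lebesgueDim X = d)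
    (hA : ∀ A : AddSubgroup (Fin k → ℤ), A.index ≠ 0 → A.index ≤ 2 * d →
      ((lebesgueDim (fixedSet X A) : ℕ∞) : ℝ≥0∞) / (A.index : ℝ≥0∞) < (m : ℝ≥0∞) / 2) :
    {f : C(X, Fin m → I) | IsEmbedding (delayMap (k := k) (2 * d) f)} ∈
      residual C(X, Fin m → I) := by
  choose! W hW hres using exists_nhdsWithin_separated (k := k) hm hX hA
  have hpat : ∀ τ, {f : C(X, Fin m → I) | ∀ w : X × X, w.1 ≠ w.2 →
      orbitPattern (k := k) (8 * d) w = τ → ∃ i ∈ box k 0 (2 * d : ℕ),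
        f (i +ᵥ w.1) ≠ f (i +ᵥ w.2)} ∈ residual C(X, Fin m → I) := by
    intro τ
    obtain ⟨t, ht, htc, hcov⟩ := TopologicalSpace.countable_cover_nhdsWithin (f := W)
      (s := {w : X × X | w.1 ≠ w.2 ∧ orbitPattern (k := k) (8 * d) w = τ}) fun w hw =>
        nhdsWithin_mono w (fun w' hw' => hw'.2.trans hw.2.symm) (hW w hw.1)
    refine mem_of_superset ((countable_bInter_mem htc).2 fun w hw => hres w (ht hw).1) ?_
    intro f hf w hw hwτ
    obtain ⟨w₀, hw₀, hmem⟩ := mem_iUnion₂.1 (hcov ⟨hw, hwτ⟩)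
    exact mem_iInter₂.1 hf w₀ hw₀ w hmem
  refine mem_of_superset (countable_iInter_mem.2 hpat) fun f hf => ?_
  have hcont : Continuous (delayMap (k := k) (2 * d) f) :=
    continuous_pi fun i => f.continuous.comp (continuous_const_vadd _)
  refine (hcont.isClosedEmbedding fun x y hxy => ?_).isEmbedding
  by_contra hne
  obtain ⟨i, hi, hfi⟩ := mem_iInter.1 hf _ (x, y) hne rfl
  refine hfi (congrFun hxy ⟨i, ?_⟩)
  exact Finset.mem_Icc.1 hi

end Separation

/-! ### Mean dimension of actions of finite groups -/

section MeanDimension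

theorem lebesgueDim_of_isEmpty {X : Type*} [TopologicalSpace X] [IsEmpty X] :
    lebesgueDim X = 0 := by
  refine nonpos_iff_eq_zero.1 (iSup₂_le fun α _ => ?_)
  refine (coverDim_le (β := ∅) ⟨finite_empty, by simp, by simp [eq_iff_true_of_subsingleton]⟩
    (by simp [Refines])).trans ?_
  simp [coverOrder]

/-- The dimension of a compact metric space is bounded by its widths at small scales. -/
theorem lebesgueDim_le_iSup_widim {X : Type*} [MetricSpace X] [CompactSpace X] [Nonempty X]
    {ρ : X → X → ℝ≥0} (hρ : ∀ x y, nndist x y ≤ ρ x y) :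
    lebesgueDim X ≤ ⨆ (ε : ℝ≥0) (_ : 0 < ε), widim ρ ε := by
  refine iSup₂_le fun α hα => ?_
  obtain ⟨δ, hδ, hL⟩ := lebesgue_number_lemma_of_metric_sUnion isCompact_univ hα.2.1 hα.2.2.ge
  refine le_trans ?_ (le_iSup₂ (f := fun ε (_ : 0 < ε) => widim ρ ε) (Real.toNNReal (δ / 2))
    (Real.toNNReal_pos.2 (half_pos hδ)))
  refine le_iInf fun β => le_iInf fun hβ => le_iInf fun hdiam => coverDim_le hβ fun V hV => ?_
  -- An empty member must also lie in a member of `α`; a point of `X` provides one.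
  rcases V.eq_empty_or_nonempty with rfl | ⟨x, hx⟩
  · obtain ⟨x⟩ := ‹Nonempty X›
    obtain ⟨U, hU, -⟩ := hL x (mem_univ x)
    exact ⟨U, hU, empty_subset _⟩
  · obtain ⟨U, hU, hb⟩ := hL x (mem_univ x)
    refine ⟨U, hU, fun y hy => hb ?_⟩
    have h : (nndist y x : ℝ) ≤ Real.toNNReal (δ / 2) :=
      NNReal.coe_le_coe.2 ((hρ y x).trans (hdiam V hV y hy x hx))
    rw [Real.coe_toNNReal _ (half_pos hδ).le, coe_nndist] at h
    exact h.trans_lt (half_lt_self hδ)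

/-- The whole of a finite group is a Følner set of every quality. -/
theorem pure_univ_le_folner (G : Type*) [AddCommGroup G] [Fintype G] :
    pure Finset.univ ≤ folner G := by
  classical
  refine le_iInf fun K => le_iInf fun δ => le_iInf fun hδ => ?_
  rw [le_principal_iff, mem_pure]
  refine ⟨Finset.univ_nonempty, fun g _ => ?_⟩
  rw [Finset.image_univ_of_surjective (add_left_surjective g), symmDiff_self]
  simp only [Finset.bot_eq_empty, Finset.card_empty, Nat.cast_zero]
  positivity

/-- The whole group lies in every basic Følner set, so its term bounds the limsup from below. Its
metric dominates the original one, so its widths bound the dimension. -/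
theorem lebesgueDim_div_card_le_meanDim {G X : Type*} [AddCommGroup G] [Finite G] [MetricSpace X]
    [CompactSpace X] [AddAction G X] :
    ((lebesgueDim X : ℕ∞) : ℝ≥0∞) / (Nat.card G : ℝ≥0∞) ≤ meanDim G X := by
  have := Fintype.ofFinite G
  rcases isEmpty_or_nonempty X with hX | hX
  · rw [lebesgueDim_of_isEmpty]
    simp
  have hdim := lebesgueDim_le_iSup_widim (X := X) (ρ := dynDist (Finset.univ : Finset G))
    fun x y => by
      have := Finset.le_sup (f := fun g : G => nndist (g +ᵥ x) (g +ᵥ y)) (Finset.mem_univ 0)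
      simpa [dynDist] using this
  refine (ENNReal.div_le_div_right (ENat.toENNReal_le.2 hdim) _).trans ?_
  simp only [ENat.toENNReal_iSup, ENNReal.iSup_div]
  refine iSup₂_mono fun ε hε => le_limsup_of_frequently_le ?_
  refine Frequently.filter_mono ?_ (pure_univ_le_folner G)
  rw [frequently_pure, Finset.card_univ, Nat.card_eq_fintype_card]

end MeanDimension

end TakensZk

theorem mainTheorem4 (k : ℕ) (hk : 1 ≤ k) (X : Type*) [MetricSpace X] [CompactSpace X]
    [AddAction (Fin k → ℤ) X] [ContinuousConstVAdd (Fin k → ℤ) X] :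
    (∀ d m : ℕ, 1 ≤ m → TakensZk.lebesgueDim X = (d : ℕ∞) →
      (∀ A : AddSubgroup (Fin k → ℤ), A.index ≠ 0 → A.index ≤ 2 * d →
        ((TakensZk.lebesgueDim (TakensZk.fixedSet X A) : ℕ∞) : ℝ≥0∞) / (A.index : ℝ≥0∞)
          < (m : ℝ≥0∞) / 2) →
      {f : C(X, Fin m → I) | IsEmbedding (TakensZk.delayMap (k := k) (2 * d) f)}
        ∈ residual C(X, Fin m → I)) ∧
    (∀ D : ℕ, 1 ≤ D → TakensZk.lebesgueDim X ≠ ⊤ →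
      (∀ A : AddSubgroup (Fin k → ℤ),
        TakensZk.meanDim ((Fin k → ℤ) ⧸ A) (TakensZk.fixedSet X A) < (D : ℝ≥0∞) / 2) →
      ∃ φ : X → ((Fin k → ℤ) → (Fin D → I)), IsEmbedding φ ∧
        ∀ (n : Fin k → ℤ) (x : X), φ (n +ᵥ x) = TakensZk.shift n (φ x)) := by
  refine ⟨fun d m hm hX hA => TakensZk.residual_isEmbedding_delayMap hm hX hA,
    fun D hD hX hA => ?_⟩
  obtain ⟨d, hd⟩ := ENat.ne_top_iff_exists.1 hX
  have hres := TakensZk.residual_isEmbedding_delayMap (k := k) hD hd.symm fun A hA0 _ => by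
    -- Index zero stands for infinite index, so only finite quotients occur here.
    have : A.FiniteIndex := ⟨hA0⟩
    have : Finite ((Fin k → ℤ) ⧸ A) := AddSubgroup.finite_quotient_of_finiteIndex
    have : CompactSpace (TakensZk.fixedSet X A) := isCompact_iff_compactSpace.1
      (TakensZk.isClosed_setOf_forall_vadd_eq (X := X) fun b => b ∈ A).isCompact
    exact TakensZk.lebesgueDim_div_card_le_meanDim.trans_lt (hA A)
  obtain ⟨f, hf⟩ := (dense_of_mem_residual hres).nonempty
  have hcont : Continuous fun (x : X) (w : Fin k → ℤ) => f (w +ᵥ x) :=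
    continuous_pi fun w => f.continuous.comp (continuous_const_vadd w)
  refine ⟨fun x w => f (w +ᵥ x), (hcont.isClosedEmbedding fun x y hxy => ?_).isEmbedding,
    fun n x => ?_⟩
  · refine hf.injective ?_
    funext i
    exact congrFun hxy i
  · funext w
    simp only [TakensZk.shift, add_vadd]
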